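/- Let $\mathfrak D$ be the set of all $\rho\in M_3(\mathbb C)\otimes M_3(\mathbb C)$ such that $\rho=\rho^*$, $\operatorname{Tr}\rho=3$, $\rho$ is block-positive, i.e. $(x\otimes y,\rho\,(x\otimes y))\ge 0$ for all $x,y\in\mathbb C^3$, and $\alpha(\rho)=1$. Here $$\alpha(\rho)=\sup_{a\neq 0}\frac{|\operatorname{Tr}\rho a|}{\pi(a)},\qquad \pi(a)=\inf\Big\{\sum_i\|a_i\|\,\|b_i\|_1 \;:\; a=\sum_i a_i\otimes b_i\Big\},$$ where the supremum is over $a\in M_3(\mathbb C)\otimes M_3(\mathbb C)$, the infimum is over finite decompositions with $a_i,b_i\in M_3(\mathbb C)$, $\|\cdot\|$ is the operator norm and $\|b\|_1=\operatorname{Tr}(b^*b)^{1/2}$ is the trace norm. Let $s\in\mathfrak D$ be a symmetry, i.e. $s=s^*$ and $s^2=\mathbb 1$, and write $s=p-q$ with orthogonal projectors $p,q$ such that $p+q=\mathbb 1$. Then every normalized eigenvector $\xi\in\mathbb C^3\otimes\mathbb C^3$ of $q$ with nonzero eigenvalue (that is, every unit vector in the range of $q$) has Schmidt rank $2$ with both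 Schmidt coefficients equal to $1/\sqrt2$: there are orthonormal pairs $e_1,e_2$ and $f_1,f_2$ in $\mathbb C^3$ with $\xi=\tfrac1{\sqrt2}(e_1\otimes f_1+e_2\otimes f_2)$, and every Schmidt decomposition of $\xi$ (with orthonormal systems and positive coefficients) has exactly two terms, both with coefficient $1/\sqrt2$. -/

import Mathlib

open scoped Matrix Kronecker ComplexOrder MatrixOrder Matrix.Norms.L2Operator

namespace BlockPositive

noncomputable section

/-- `M_n ⊗ M_n`, realised through the Kronecker product as the algebra of matrices indexed by
pairs; `a ⊗ b` is `a ⊗ₖ b`. -/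
abbrev BiMatrix (n : ℕ) : Type := Matrix (Fin n × Fin n) (Fin n × Fin n) ℂ

/-- The Hilbert space `ℂⁿ ⊗ ℂⁿ`, realised as `ℂ^(n × n)` with its Euclidean norm. -/
abbrev BiVector (n : ℕ) : Type := EuclideanSpace ℂ (Fin n × Fin n)

/-- The product vector `x ⊗ y`. -/
def tensorVec {n : ℕ} (x y : EuclideanSpace ℂ (Fin n)) : BiVector n :=
  WithLp.toLp 2 fun i => x i.1 * y i.2

/-- `(x ⊗ y, ρ (x ⊗ y)) ≥ 0` for all `x, y ∈ ℂⁿ`. -/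
def IsBlockPositive {n : ℕ} (ρ : BiMatrix n) : Prop :=
  ∀ x y : EuclideanSpace ℂ (Fin n),
    0 ≤ inner ℂ (tensorVec x y) (Matrix.toEuclideanLin ρ (tensorVec x y))

/-- The trace norm `Tr |b|`, `|b| = (b* b)^(1/2)`. -/
def traceNorm {n : ℕ} (b : Matrix (Fin n) (Fin n) ℂ) : ℝ :=
  (CFC.sqrt (bᴴ * b)).trace.re

/-- The projective norm `π(x)`: the infimum of `∑ ‖aᵢ‖ ‖bᵢ‖₁` over all finite decompositions
`x = ∑ aᵢ ⊗ bᵢ`, with the operator norm on the first factor and the trace norm on the second. -/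
def projNorm {n : ℕ} (x : BiMatrix n) : ℝ :=
  sInf {r : ℝ | ∃ (k : ℕ) (a b : Fin k → Matrix (Fin n) (Fin n) ℂ),
    x = ∑ i, a i ⊗ₖ b i ∧ r = ∑ i, ‖a i‖ * traceNorm (b i)}

/-- The norm `α` dual to the projective norm under the pairing `(ρ, a) ↦ Tr (ρ a)`. -/
def alphaNorm {n : ℕ} (ρ : BiMatrix n) : ℝ :=
  sSup {r : ℝ | ∃ a : BiMatrix n, a ≠ 0 ∧ r = ‖(ρ * a).trace‖ / projNorm a}

/-- The set `𝔇` of the Choi matrices of normalised unital positive maps on `M_n`. -/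
def setD (n : ℕ) : Set (BiMatrix n) :=
  {ρ | ρ.IsHermitian ∧ alphaNorm ρ = 1 ∧ IsBlockPositive ρ ∧ ρ.trace = n}

/-- A symmetry is a selfadjoint unitary. -/
def IsSymmetry {n : ℕ} (s : BiMatrix n) : Prop :=
  s.IsHermitian ∧ s * s = 1

/-- `v = ∑ cᵢ eᵢ ⊗ fᵢ` is a Schmidt decomposition of `v`: the `eᵢ` are orthonormal, the `fᵢ` are
orthonormal and the `k` coefficients `cᵢ` are positive. Then `k` is the Schmidt rank of `v` and
the `cᵢ` are its Schmidt coefficients. -/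
structure IsSchmidtDecomposition {n k : ℕ} (v : BiVector n) (c : Fin k → ℝ)
    (e f : Fin k → EuclideanSpace ℂ (Fin n)) : Prop where
  coeff_pos : ∀ i, 0 < c i
  orthonormal_left : Orthonormal ℂ e
  orthonormal_right : Orthonormal ℂ f
  eq_sum : v = ∑ i, (c i : ℂ) • tensorVec (e i) (f i)

end

end BlockPositive

/-! A symmetry `s = 1 - 2q` of trace `3` on `ℂ³ ⊗ ℂ³` has `q` of rank `3`, and block positivity
says that `q` maps unit product vectors to vectors of norm at most `1/√2`. Hence all Schmidt
coefficients of a unit vector in the range `W` of `q` are at most `1/√2`, and as their squares sum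
to `1` the claim follows once the Schmidt rank is at most `2`, i.e. once every `v ∈ W` has a
singular coefficient matrix.

A pencil of matrices contains a singular one, so some `v₀ ∈ W` is singular, say
`v₀ = (e₁ ⊗ f₁ + e₂ ⊗ f₂) / √2`. On the product vectors `x ⊗ y` with `x = a₁ e₁ + a₂ e₂` and
`y = a̅₁ f₁ + a̅₂ f₂` the bound is already exhausted by `v₀`, so these are orthogonal to every
`w ∈ W` with `w ⊥ v₀`. By polarization `w` is orthogonal to all four `eᵢ ⊗ fⱼ`, and a `3 × 3` matrix
with a vanishing `2 × 2` block is singular. Since `dim W = 3`, any `v ∈ W` is reached from `v₀` in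
two such steps, through a vector orthogonal to both. -/

namespace BlockPositive

section InnerProductSpace

variable {𝕜 E : Type*} [RCLike 𝕜] [NormedAddCommGroup E] [InnerProductSpace 𝕜 E]

lemma inner_eq_inner_starProjection_of_mem {K : Submodule 𝕜 E} [K.HasOrthogonalProjection]
    {u : E} (hu : u ∈ K) (v : E) : inner 𝕜 v u = inner 𝕜 (K.starProjection v) u := by
  rw [Submodule.inner_starProjection_left_eq_right, Submodule.starProjection_eq_self_iff.2 hu]

lemma eq_smul_of_norm_le_of_inner_eq {z v : E} {r : ℝ} (hv : ‖v‖ = 1) (hz : ‖z‖ ≤ r)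
    (hzv : inner 𝕜 z v = (r : 𝕜)) : z = (r : 𝕜) • v := by
  have hdist : ‖z - (r : 𝕜) • v‖ ^ 2 = ‖z‖ ^ 2 - r ^ 2 := by
    rw [norm_sub_sq (𝕜 := 𝕜), inner_smul_right, hzv, norm_smul, hv, mul_one, RCLike.norm_ofReal,
      sq_abs, ← RCLike.ofReal_mul, RCLike.ofReal_re]
    ring
  have hle : ‖z‖ ^ 2 ≤ r ^ 2 := pow_le_pow_left₀ (norm_nonneg _) hz 2
  have hzero : ‖z - (r : 𝕜) • v‖ ^ 2 = 0 := le_antisymm (by linarith) (sq_nonneg _)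
  simpa [sub_eq_zero] using hzero

lemma norm_sq_sum_smul_of_orthonormal {ι : Type*} [Fintype ι] {g : ι → E}
    (hg : Orthonormal 𝕜 g) (b : ι → 𝕜) :
    ‖∑ i, b i • g i‖ ^ 2 = ∑ i, ‖b i‖ ^ 2 := by
  have h := hg.inner_sum b b Finset.univ
  rw [inner_self_eq_norm_sq_to_K] at h
  simp only [RCLike.conj_mul] at h
  exact_mod_cast h

lemma exists_ne_zero_inner_eq_zero_of_two_lt_finrank {W : Submodule 𝕜 E}
    (hW : 2 < Module.finrank 𝕜 W) (u v : E) :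
    ∃ z ∈ W, z ≠ 0 ∧ inner 𝕜 u z = 0 ∧ inner 𝕜 v z = 0 := by
  have : FiniteDimensional 𝕜 W := FiniteDimensional.of_finrank_pos (by omega)
  let φ : W →ₗ[𝕜] 𝕜 × 𝕜 := ((innerₛₗ 𝕜 u).prod (innerₛₗ 𝕜 v)) ∘ₗ W.subtype
  obtain ⟨z, hz, hz0⟩ := (Submodule.ne_bot_iff _).1
    (LinearMap.ker_ne_bot_of_finrank_lt (f := φ) (by simpa using hW))
  obtain ⟨huz, hvz⟩ := Prod.mk.inj (LinearMap.mem_ker.1 hz)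
  exact ⟨z, z.2, by simpa using hz0, huz, hvz⟩

end InnerProductSpace

section Matrix

lemma exists_ne_zero_det_eq_zero_of_one_lt_finrank {K m : Type*} [Field K] [IsAlgClosed K]
    [Fintype m] [DecidableEq m] {W : Submodule K (Matrix m m K)}
    (hW : 1 < Module.finrank K W) : ∃ A ∈ W, A ≠ 0 ∧ A.det = 0 := by
  have : Nontrivial W := Module.nontrivial_of_finrank_pos (R := K) (by omega)
  obtain ⟨B, hB⟩ := exists_ne (0 : W)
  have : Nonempty m := not_isEmpty_iff.1 fun _ => hB (Subsingleton.elim _ _)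
  obtain ⟨A, hBA⟩ := exists_linearIndependent_pair_of_one_lt_finrank hW hB
  by_cases hdet : (B : Matrix m m K).det = 0
  · exact ⟨B, B.2, by simpa using hB, hdet⟩
  obtain ⟨t, ht⟩ := spectrum.nonempty_of_isAlgClosed_of_finiteDimensional K
    ((B : Matrix m m K)⁻¹ * A)
  refine ⟨t • B - A, (t • B - A).2, fun h0 => ?_, ?_⟩
  · have hpair := LinearIndependent.pair_iff.1 hBA t (-1) (by
      rw [neg_one_smul, ← sub_eq_add_neg]; exact Subtype.ext h0)
    simp at hpair
  · have hfactor : t • (B : Matrix m m K) - A =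
        B * (algebraMap K _ t - (B : Matrix m m K)⁻¹ * A) := by
      rw [mul_sub, ← mul_assoc, Matrix.mul_nonsing_inv _ (isUnit_iff_ne_zero.2 hdet), one_mul,
        Algebra.algebraMap_eq_smul_one, mul_smul_comm, mul_one]
    rw [spectrum.mem_iff, Matrix.isUnit_iff_isUnit_det, isUnit_iff_ne_zero, not_not] at ht
    rw [hfactor, Matrix.det_mul, ht, mul_zero]

lemma natCast_rank_eq_trace {m K : Type*} [Field K] [Fintype m] {q : Matrix m m K}
    (hq : IsIdempotentElem q) : (q.rank : K) = q.trace := by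
  classical
  have h := (LinearMap.IsIdempotentElem.isProj_range _
    (hq.map (Matrix.toLinAlgEquiv' (R := K)))).trace
  rw [← Matrix.trace_toLin'_eq]
  exact h.symm

lemma toEuclideanCLM_eq_starProjection {𝕜 m : Type*} [RCLike 𝕜] [Fintype m] [DecidableEq m]
    {q : Matrix m m 𝕜} (hq : IsStarProjection q) :
    Matrix.toEuclideanCLM (n := m) (𝕜 := 𝕜) q =
      (LinearMap.range (Matrix.toEuclideanLin q)).starProjection := by
  obtain ⟨_, h⟩ := isStarProjection_iff_eq_starProjection_range.1
    (hq.map (Matrix.toEuclideanCLM (n := m) (𝕜 := 𝕜)))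
  exact h

end Matrix

section Tensor

variable {n : ℕ}

lemma inner_tensorVec_tensorVec (x y x' y' : EuclideanSpace ℂ (Fin n)) :
    inner ℂ (tensorVec x y) (tensorVec x' y') = inner ℂ x x' * inner ℂ y y' := by
  simp only [PiLp.inner_apply, Fintype.sum_prod_type, Finset.sum_mul_sum, tensorVec,
    RCLike.inner_apply, map_mul]
  exact Finset.sum_congr rfl fun i _ => Finset.sum_congr rfl fun j _ => by ring

lemma norm_tensorVec (x y : EuclideanSpace ℂ (Fin n)) : ‖tensorVec x y‖ = ‖x‖ * ‖y‖ := by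
  have h : ‖tensorVec x y‖ ^ 2 = (‖x‖ * ‖y‖) ^ 2 := by
    have h := inner_tensorVec_tensorVec x y x y
    simp only [inner_self_eq_norm_sq_to_K] at h
    rw [mul_pow]
    exact_mod_cast h
  exact (sq_eq_sq₀ (norm_nonneg _) (by positivity)).1 h

/-- The product vector `x ⊗ y` as a bilinear map in `x` and `y`. -/
def tensorVecₗ (n : ℕ) :
    EuclideanSpace ℂ (Fin n) →ₗ[ℂ] EuclideanSpace ℂ (Fin n) →ₗ[ℂ] BiVector n :=
  LinearMap.mk₂ ℂ tensorVec
    (fun _ _ _ => by ext; simp [tensorVec, add_mul])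
    (fun _ _ _ => by ext; simp [tensorVec, mul_assoc])
    (fun _ _ _ => by ext; simp [tensorVec, mul_add])
    (fun _ _ _ => by ext; simp [tensorVec, mul_left_comm])

lemma tensorVecₗ_apply (x y : EuclideanSpace ℂ (Fin n)) : tensorVecₗ n x y = tensorVec x y := rfl

lemma tensorVec_smul_left (a : ℂ) (x y : EuclideanSpace ℂ (Fin n)) :
    tensorVec (a • x) y = a • tensorVec x y := by
  simp only [← tensorVecₗ_apply, map_smul, LinearMap.smul_apply]

lemma tensorVec_sum_smul_right {κ : Type*} [Fintype κ] (x : EuclideanSpace ℂ (Fin n)) (b : κ → ℂ)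
    (f : κ → EuclideanSpace ℂ (Fin n)) :
    tensorVec x (∑ j, b j • f j) = ∑ j, b j • tensorVec x (f j) := by
  simp only [← tensorVecₗ_apply, map_sum, map_smul]

lemma tensorVec_sum_smul_sum_smul {ι κ : Type*} [Fintype ι] [Fintype κ] (a : ι → ℂ)
    (e : ι → EuclideanSpace ℂ (Fin n)) (b : κ → ℂ)
    (f : κ → EuclideanSpace ℂ (Fin n)) :
    tensorVec (∑ i, a i • e i) (∑ j, b j • f j) =
      ∑ i, ∑ j, (a i * b j) • tensorVec (e i) (f j) := by
  simp only [← tensorVecₗ_apply, map_sum, map_smul, LinearMap.sum_apply, LinearMap.smul_apply,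
    Finset.smul_sum, smul_smul]
  rw [Finset.sum_comm]
  simp only [mul_comm]

lemma ext_inner_tensorVec {v w : BiVector n}
    (h : ∀ x y, inner ℂ (tensorVec x y) v = inner ℂ (tensorVec x y) w) : v = w := by
  ext ⟨i, j⟩
  have hsingle : tensorVec (EuclideanSpace.single i 1) (EuclideanSpace.single j 1) =
      EuclideanSpace.single (i, j) (1 : ℂ) := by
    ext ⟨i', j'⟩
    simp only [tensorVec, PiLp.single_apply, Prod.mk.injEq, ite_and, ite_mul, one_mul,
      zero_mul]
  simpa [hsingle, EuclideanSpace.inner_single_left] using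
    h (EuclideanSpace.single i 1) (EuclideanSpace.single j 1)

end Tensor

section CoeffMatrix

variable {n : ℕ}

/-- The matrix of coefficients of a vector of `ℂⁿ ⊗ ℂⁿ` in the standard product basis; its rank is
the Schmidt rank of the vector. -/
def coeffMatrix (n : ℕ) : BiVector n ≃ₗ[ℂ] Matrix (Fin n) (Fin n) ℂ :=
  WithLp.linearEquiv 2 ℂ (Fin n × Fin n → ℂ) ≪≫ₗ LinearEquiv.curry ℂ ℂ (Fin n) (Fin n) ≪≫ₗ
    Matrix.ofLinearEquiv ℂ

lemma coeffMatrix_apply (v : BiVector n) (i j : Fin n) : coeffMatrix n v i j = v (i, j) := rfl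

/-- The partial inner product `(1 ⊗ ⟨y|) v` of `v` with `y` in the second factor; it is
antilinear in `y`. -/
def contractRight (v : BiVector n) (y : EuclideanSpace ℂ (Fin n)) : EuclideanSpace ℂ (Fin n) :=
  WithLp.toLp 2 (coeffMatrix n v *ᵥ star y.ofLp)

lemma inner_contractRight (v : BiVector n) (x y : EuclideanSpace ℂ (Fin n)) :
    inner ℂ x (contractRight v y) = inner ℂ (tensorVec x y) v := by
  simp only [PiLp.inner_apply, Fintype.sum_prod_type, tensorVec, contractRight, coeffMatrix_apply,
    Matrix.mulVec, dotProduct, RCLike.inner_apply, map_mul, Finset.sum_mul, starRingEnd_apply,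
    Pi.star_apply]
  exact Finset.sum_congr rfl fun i _ => Finset.sum_congr rfl fun j _ => by ring

lemma det_coeffMatrix_eq_zero_iff {v : BiVector n} :
    (coeffMatrix n v).det = 0 ↔ ∃ y ≠ 0, ∀ x, inner ℂ (tensorVec x y) v = 0 := by
  have hcontract : ∀ y, (∀ x, inner ℂ (tensorVec x y) v = 0) ↔ contractRight v y = 0 := fun y => by
    simp only [← inner_contractRight]
    exact ⟨fun h => inner_self_eq_zero.1 (h _), fun h x => by rw [h, inner_zero_right]⟩
  simp only [hcontract, ← Matrix.exists_mulVec_eq_zero_iff]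
  constructor
  · rintro ⟨y, hy, h⟩
    exact ⟨WithLp.toLp 2 (star y), by simpa using hy, by simp [contractRight, h]⟩
  · rintro ⟨y, hy, h⟩
    exact ⟨star y.ofLp, by simpa using hy, by simpa [contractRight] using h⟩

lemma det_coeffMatrix_smul_eq_zero_iff {a : ℂ} (ha : a ≠ 0) {v : BiVector n} :
    (coeffMatrix n (a • v)).det = 0 ↔ (coeffMatrix n v).det = 0 := by
  simp [ha]

lemma det_coeffMatrix_eq_zero_of_inner_eq_zero {ι κ : Type*} [Fintype ι] [Fintype κ]
    {v : BiVector n} {e : ι → EuclideanSpace ℂ (Fin n)} {f : κ → EuclideanSpace ℂ (Fin n)}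
    (he : LinearIndependent ℂ e) (hf : LinearIndependent ℂ f)
    (hcard : n < Fintype.card ι + Fintype.card κ)
    (h : ∀ i j, inner ℂ (tensorVec (e i) (f j)) v = 0) : (coeffMatrix n v).det = 0 := by
  let U := Submodule.span ℂ (Set.range e)
  let V := Submodule.span ℂ (Set.range f)
  let φ := ((tensorVecₗ n).compr₂ (innerₛₗ ℂ v)).flip
  have hmap : V.map φ ≤ U.dualAnnihilator := by
    rw [Submodule.map_span_le]
    rintro _ ⟨j, rfl⟩
    have hU : U ≤ LinearMap.ker (φ (f j)) := by
      rw [Submodule.span_le]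
      rintro _ ⟨i, rfl⟩
      exact inner_eq_zero_symm.1 (h i j)
    exact (Submodule.mem_dualAnnihilator _).2 hU
  have hker : LinearMap.ker φ ≠ ⊥ := fun hinj => by
    have hle : Fintype.card κ ≤ Module.finrank ℂ U.dualAnnihilator := by
      rw [← finrank_span_eq_card hf,
        (V.equivMapOfInjective φ (LinearMap.ker_eq_bot.1 hinj)).finrank_eq]
      exact Submodule.finrank_mono hmap
    have hadd : Fintype.card ι + Module.finrank ℂ U.dualAnnihilator = n := by
      rw [← finrank_span_eq_card he]
      exact (Subspace.finrank_add_finrank_dualAnnihilator_eq U).trans finrank_euclideanSpace_fin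
    omega
  obtain ⟨y, hy, hy0⟩ := (Submodule.ne_bot_iff _).1 hker
  exact det_coeffMatrix_eq_zero_iff.2
    ⟨y, hy0, fun x => inner_eq_zero_symm.1 (LinearMap.congr_fun hy x)⟩

end CoeffMatrix

section Schmidt

variable {n : ℕ}

namespace IsSchmidtDecomposition

variable {k : ℕ} {v : BiVector n} {c : Fin k → ℝ} {e f : Fin k → EuclideanSpace ℂ (Fin n)}

lemma inner_tensorVec (h : IsSchmidtDecomposition v c e f) (i : Fin k) :
    inner ℂ (tensorVec (e i) (f i)) v = c i := by
  rw [h.eq_sum, inner_sum]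
  simp [inner_tensorVec_tensorVec, orthonormal_iff_ite.1 h.orthonormal_left,
    orthonormal_iff_ite.1 h.orthonormal_right]

lemma sum_sq_eq_norm_sq (h : IsSchmidtDecomposition v c e f) : ∑ i, c i ^ 2 = ‖v‖ ^ 2 := by
  have hinner : inner ℂ v v = ((∑ i, c i ^ 2 : ℝ) : ℂ) := by
    nth_rewrite 1 [h.eq_sum]
    simp [h.inner_tensorVec, sq]
  rw [← inner_self_eq_norm_sq (𝕜 := ℂ), hinner]
  rfl

lemma lt_of_det_coeffMatrix_eq_zero (h : IsSchmidtDecomposition v c e f)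
    (hdet : (coeffMatrix n v).det = 0) : k < n := by
  obtain ⟨y, hy, hyv⟩ := det_coeffMatrix_eq_zero_iff.1 hdet
  have hy_orth : ∀ i, inner ℂ y (f i) = 0 := fun i => by
    have hi := hyv (e i)
    rw [h.eq_sum, inner_sum] at hi
    simpa [inner_tensorVec_tensorVec, orthonormal_iff_ite.1 h.orthonormal_left,
      (h.coeff_pos i).ne'] using hi
  have hspan : Submodule.span ℂ (Set.range f) ≠ ⊤ := by
    refine fun htop => hy ?_
    have hle : Submodule.span ℂ (Set.range f) ≤ (ℂ ∙ y)ᗮ := by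
      rw [Submodule.span_le]
      rintro _ ⟨i, rfl⟩
      exact Submodule.mem_orthogonal_singleton_iff_inner_right.2 (hy_orth i)
    rw [htop] at hle
    exact inner_self_eq_zero.1
      (Submodule.mem_orthogonal_singleton_iff_inner_right.1 (hle Submodule.mem_top))
  simpa [finrank_span_eq_card h.orthonormal_right.linearIndependent] using
    Submodule.finrank_lt hspan

lemma inner_tensorVec_sum_smul (h : IsSchmidtDecomposition v c e f) (a : Fin k → ℂ) :
    inner ℂ (tensorVec (∑ i, a i • e i) (∑ i, star (a i) • f i)) v =
      ((∑ i, c i * ‖a i‖ ^ 2 : ℝ) : ℂ) := by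
  rw [tensorVec_sum_smul_sum_smul, h.eq_sum]
  simp [inner_tensorVec_tensorVec, orthonormal_iff_ite.1 h.orthonormal_left,
    orthonormal_iff_ite.1 h.orthonormal_right, Complex.conj_mul']

lemma eq_of_le_inv_sqrt (h : IsSchmidtDecomposition v c e f) (hv : ‖v‖ = 1) {m : ℕ} (hk : k ≤ m)
    (hc : ∀ i, c i ≤ 1 / √m) : k = m ∧ ∀ i, c i = 1 / √m := by
  have hsq : ∀ i ∈ Finset.univ, c i ^ 2 ≤ 1 / m := fun i _ => by
    have hi := pow_le_pow_left₀ (h.coeff_pos i).le (hc i) 2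
    rwa [div_pow, one_pow, Real.sq_sqrt m.cast_nonneg] at hi
  have hsum : ∑ i, c i ^ 2 = 1 := by rw [h.sum_sq_eq_norm_sq, hv, one_pow]
  have hm : (0 : ℝ) < m := by
    rcases m.eq_zero_or_pos with rfl | hm
    · obtain rfl : k = 0 := by omega
      simp at hsum
    · exact_mod_cast hm
  have hkm : k = m := by
    have hle := Finset.sum_le_card_nsmul _ _ _ hsq
    rw [hsum, Finset.card_univ, Fintype.card_fin, nsmul_eq_mul, mul_one_div, one_le_div hm] at hle
    exact le_antisymm hk (by exact_mod_cast hle)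
  subst hkm
  refine ⟨rfl, fun i => ?_⟩
  have heq : c i ^ 2 = 1 / k := (Finset.sum_eq_sum_iff_of_le hsq).1
    (by simp [hsum, hm.ne']) i (Finset.mem_univ i)
  rw [← Real.sqrt_sq (h.coeff_pos i).le, heq, Real.sqrt_div zero_le_one, Real.sqrt_one]

end IsSchmidtDecomposition

lemma eq_sum_tensorVec_contractRight {ι : Type*} [Fintype ι] (v : BiVector n)
    (b : OrthonormalBasis ι ℂ (EuclideanSpace ℂ (Fin n))) :
    v = ∑ i, tensorVec (contractRight v (b i)) (b i) := by
  refine ext_inner_tensorVec fun x y => ?_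
  calc inner ℂ (tensorVec x y) v
      = inner ℂ (tensorVec x (∑ i, inner ℂ (b i) y • b i)) v := by rw [b.sum_repr']
    _ = ∑ i, inner ℂ (tensorVec x y) (tensorVec (contractRight v (b i)) (b i)) := by
      simp [tensorVec_sum_smul_right, inner_tensorVec_tensorVec,
        inner_contractRight, mul_comm]
    _ = inner ℂ (tensorVec x y) (∑ i, tensorVec (contractRight v (b i)) (b i)) := by
      rw [inner_sum]

lemma inner_contractRight_contractRight (v : BiVector n) (y z : EuclideanSpace ℂ (Fin n)) :
    inner ℂ (contractRight v y) (contractRight v z) =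
      inner ℂ (Matrix.toEuclideanLin ((coeffMatrix n v)ᴴ * coeffMatrix n v)ᵀ z) y := by
  rw [EuclideanSpace.inner_eq_star_dotProduct, EuclideanSpace.inner_eq_star_dotProduct,
    Matrix.toLpLin_apply, dotProduct_comm]
  simp only [contractRight, Matrix.star_mulVec, Matrix.mulVec_transpose, ← Matrix.vecMul_vecMul,
    Matrix.star_vecMul, Matrix.conjTranspose_conjTranspose, star_star, Matrix.dotProduct_mulVec]

lemma exists_orthonormalBasis_contractRight_orthogonal (v : BiVector n) :
    ∃ b : OrthonormalBasis (Fin n) ℂ (EuclideanSpace ℂ (Fin n)),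
      Pairwise fun i j => inner ℂ (contractRight v (b i)) (contractRight v (b j)) = 0 := by
  have hA : (((coeffMatrix n v)ᴴ * coeffMatrix n v)ᵀ).IsHermitian :=
    (Matrix.isHermitian_conjTranspose_mul_self _).transpose
  refine ⟨hA.eigenvectorBasis, fun i j hij => ?_⟩
  change inner ℂ _ _ = _
  rw [inner_contractRight_contractRight, Matrix.toLpLin_apply, hA.mulVec_eigenvectorBasis]
  have hji := hA.eigenvectorBasis.orthonormal.2 hij.symm
  simpa [inner_smul_left] using Or.inr hji

lemma exists_isSchmidtDecomposition_of_eq_sum {ι : Type*} [Fintype ι] {v : BiVector n}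
    {u g : ι → EuclideanSpace ℂ (Fin n)} (hu : Pairwise fun i j => inner ℂ (u i) (u j) = 0)
    (hg : Orthonormal ℂ g) (hv : v = ∑ i, tensorVec (u i) (g i)) :
    ∃ (k : ℕ) (c : Fin k → ℝ) (e f : Fin k → EuclideanSpace ℂ (Fin n)),
      IsSchmidtDecomposition v c e f := by
  classical
  let σ := (Fintype.equivFin {i // u i ≠ 0}).symm
  refine ⟨_, fun j => ‖u (σ j)‖, fun j => (‖u (σ j)‖⁻¹ : ℂ) • u (σ j), fun j => g (σ j),
    fun j => norm_pos_iff.2 (σ j).2, ⟨fun j => norm_smul_inv_norm (σ j).2, fun i j hij => ?_⟩,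
    hg.comp _ (Subtype.val_injective.comp σ.injective), ?_⟩
  · have horth := hu ((Subtype.val_injective.comp σ.injective).ne hij)
    simp only [Function.comp_apply] at horth
    change inner ℂ _ _ = _
    rw [inner_smul_left, inner_smul_right, horth, mul_zero, mul_zero]
  · have hterm : ∀ i : {i // u i ≠ 0},
        (‖u i‖ : ℂ) • tensorVec ((‖u i‖⁻¹ : ℂ) • u i) (g i) = tensorVec (u i) (g i) := fun i => by
      rw [tensorVec_smul_left, smul_smul, mul_inv_cancel₀ (by simpa using i.2), one_smul]
    simp only [hterm]
    rw [σ.sum_comp fun i => tensorVec (u i) (g i), hv]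
    refine (Fintype.sum_of_injective _ Subtype.val_injective _ _ (fun i hi => ?_)
      fun _ => rfl).symm
    have hui : u i = 0 := by simpa using hi
    rw [hui, ← tensorVecₗ_apply, map_zero, LinearMap.zero_apply]

lemma exists_isSchmidtDecomposition (v : BiVector n) :
    ∃ (k : ℕ) (c : Fin k → ℝ) (e f : Fin k → EuclideanSpace ℂ (Fin n)),
      IsSchmidtDecomposition v c e f :=
  have ⟨b, hb⟩ := exists_orthonormalBasis_contractRight_orthogonal v
  exists_isSchmidtDecomposition_of_eq_sum hb b.orthonormal (eq_sum_tensorVec_contractRight v b)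

end Schmidt

section Overlap

variable {n : ℕ}

/-- The projection onto `W` maps unit product vectors to vectors of norm at most `c`, stated
homogeneously in the product vector. For `W` the range of a projection `q` and `c = 1 / √2` this is
the content of the block positivity of `1 - 2q`. -/
def ProductOverlapLE (W : Submodule ℂ (BiVector n)) (c : ℝ) : Prop :=
  ∀ x y : EuclideanSpace ℂ (Fin n), ‖W.starProjection (tensorVec x y)‖ ≤ c * (‖x‖ * ‖y‖)

namespace ProductOverlapLE

variable {W : Submodule ℂ (BiVector n)} {c : ℝ} {v w : BiVector n} {k : ℕ}
  {e f : Fin k → EuclideanSpace ℂ (Fin n)}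

lemma norm_inner_le (hW : ProductOverlapLE W c) (hvW : v ∈ W) (x y : EuclideanSpace ℂ (Fin n)) :
    ‖inner ℂ (tensorVec x y) v‖ ≤ c * (‖x‖ * ‖y‖) * ‖v‖ := by
  rw [inner_eq_inner_starProjection_of_mem hvW]
  exact (norm_inner_le_norm _ _).trans (by gcongr; exact hW x y)

lemma schmidt_coeff_le (hW : ProductOverlapLE W c) (hvW : v ∈ W) (hv : ‖v‖ = 1) {d : Fin k → ℝ}
    (h : IsSchmidtDecomposition v d e f) (i : Fin k) : d i ≤ c := by
  have hi := hW.norm_inner_le hvW (e i) (f i)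
  rw [h.inner_tensorVec, h.orthonormal_left.1, h.orthonormal_right.1, hv, mul_one, mul_one,
    mul_one, Complex.norm_real] at hi
  exact (le_abs_self _).trans hi

/-- `x ⊗ y` has the largest possible overlap with `W`, and `v` alone accounts for it. -/
lemma inner_eq_zero_of_inner_eq (hW : ProductOverlapLE W c) (hvW : v ∈ W) (hv : ‖v‖ = 1)
    (hwW : w ∈ W) (hvw : inner ℂ v w = 0) {x y : EuclideanSpace ℂ (Fin n)}
    (hxy : inner ℂ (tensorVec x y) v = (c * (‖x‖ * ‖y‖) : ℝ)) :
    inner ℂ (tensorVec x y) w = 0 := by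
  rw [inner_eq_inner_starProjection_of_mem hvW] at hxy
  rw [inner_eq_inner_starProjection_of_mem hwW,
    eq_smul_of_norm_le_of_inner_eq hv (hW x y) hxy, inner_smul_left, hvw, mul_zero]

lemma inner_tensorVec_eq_zero (hW : ProductOverlapLE W c) (hvW : v ∈ W) (hv : ‖v‖ = 1)
    (h : IsSchmidtDecomposition v (fun _ => c) e f) (hwW : w ∈ W) (hvw : inner ℂ v w = 0)
    (i j : Fin k) : inner ℂ (tensorVec (e i) (f j)) w = 0 := by
  let M : Matrix (Fin k) (Fin k) ℂ := .of fun i j => inner ℂ (tensorVec (e i) (f j)) w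
  -- By polarization it suffices to test on the vectors `∑ aᵢ eᵢ` and `∑ a̅ᵢ fᵢ`.
  have hM : Matrix.toEuclideanLin M = 0 := by
    refine (inner_map_self_eq_zero _).1 fun a => inner_eq_zero_symm.1 ?_
    calc inner ℂ a (Matrix.toEuclideanLin M a)
        = inner ℂ (tensorVec (∑ i, a i • e i) (∑ i, star (a i) • f i)) w := by
          rw [tensorVec_sum_smul_sum_smul, PiLp.inner_apply]
          simp only [M, Matrix.toLpLin_apply, Matrix.mulVec, dotProduct, sum_inner,
            inner_smul_left, Finset.sum_mul, RCLike.inner_apply, map_mul, Matrix.of_apply,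
            starRingEnd_apply, star_star]
          exact Finset.sum_congr rfl fun i _ => Finset.sum_congr rfl fun j _ => by ring
      _ = 0 := hW.inner_eq_zero_of_inner_eq hvW hv hwW hvw (by
          have hnorm : ‖∑ i, star (a i) • f i‖ = ‖∑ i, a i • e i‖ := by
            rw [← sq_eq_sq₀ (norm_nonneg _) (norm_nonneg _),
              norm_sq_sum_smul_of_orthonormal h.orthonormal_right,
              norm_sq_sum_smul_of_orthonormal h.orthonormal_left]
            simp only [norm_star]
          rw [h.inner_tensorVec_sum_smul, hnorm, ← sq,
            norm_sq_sum_smul_of_orthonormal h.orthonormal_left, Finset.mul_sum])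
  exact congrFun₂ ((LinearEquiv.map_eq_zero_iff _).1 hM) i j

section DimensionThree

variable {W : Submodule ℂ (BiVector 3)}

lemma schmidt_eq_two (hW : ProductOverlapLE W (1 / √2)) {v : BiVector 3} (hvW : v ∈ W)
    (hv : ‖v‖ = 1) (hdet : (coeffMatrix 3 v).det = 0) {k : ℕ} {c : Fin k → ℝ}
    {e f : Fin k → EuclideanSpace ℂ (Fin 3)} (h : IsSchmidtDecomposition v c e f) :
    k = 2 ∧ ∀ i, c i = 1 / √2 :=
  mod_cast h.eq_of_le_inv_sqrt (m := 2) hv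
    (Nat.le_of_lt_succ (h.lt_of_det_coeffMatrix_eq_zero hdet))
    (mod_cast hW.schmidt_coeff_le hvW hv h)

lemma exists_schmidt (hW : ProductOverlapLE W (1 / √2)) {v : BiVector 3} (hvW : v ∈ W)
    (hv : ‖v‖ = 1) (hdet : (coeffMatrix 3 v).det = 0) :
    ∃ e f : Fin 2 → EuclideanSpace ℂ (Fin 3), IsSchmidtDecomposition v (fun _ => 1 / √2) e f := by
  obtain ⟨k, c, e, f, h⟩ := exists_isSchmidtDecomposition v
  obtain ⟨rfl, hc⟩ := hW.schmidt_eq_two hvW hv hdet h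
  exact ⟨e, f, funext hc ▸ h⟩

lemma det_coeffMatrix_eq_zero_of_orthogonal (hW : ProductOverlapLE W (1 / √2))
    {v w : BiVector 3} (hvW : v ∈ W) (hv : v ≠ 0) (hdet : (coeffMatrix 3 v).det = 0)
    (hwW : w ∈ W) (hvw : inner ℂ v w = 0) : (coeffMatrix 3 w).det = 0 := by
  have ha : (‖v‖⁻¹ : ℂ) ≠ 0 := by simpa using hv
  set u := (‖v‖⁻¹ : ℂ) • v
  have hu : ‖u‖ = 1 := norm_smul_inv_norm hv
  have huW : u ∈ W := W.smul_mem _ hvW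
  obtain ⟨e, f, h⟩ := hW.exists_schmidt huW hu ((det_coeffMatrix_smul_eq_zero_iff ha).2 hdet)
  exact det_coeffMatrix_eq_zero_of_inner_eq_zero h.orthonormal_left.linearIndependent
    h.orthonormal_right.linearIndependent (by simp)
    (hW.inner_tensorVec_eq_zero huW hu h hwW (by rw [inner_smul_left, hvw, mul_zero]))

lemma det_coeffMatrix_eq_zero (hW : ProductOverlapLE W (1 / √2)) (hdim : 2 < Module.finrank ℂ W)
    {v : BiVector 3} (hv : v ∈ W) : (coeffMatrix 3 v).det = 0 := by
  obtain ⟨_, ⟨v₀, hv₀, rfl⟩, hne, hdet⟩ := exists_ne_zero_det_eq_zero_of_one_lt_finrank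
    (W := W.map (coeffMatrix 3).toLinearMap)
    (by rw [LinearEquiv.finrank_map_eq]; omega)
  obtain ⟨z, hz, hz0, hv₀z, hvz⟩ := exists_ne_zero_inner_eq_zero_of_two_lt_finrank hdim v₀ v
  have hv₀0 : v₀ ≠ 0 := by rintro rfl; exact hne (map_zero _)
  have hzdet := hW.det_coeffMatrix_eq_zero_of_orthogonal hv₀ hv₀0 hdet hz hv₀z
  exact hW.det_coeffMatrix_eq_zero_of_orthogonal hz hz0 hzdet hv (inner_eq_zero_symm.1 hvz)

end DimensionThree

end ProductOverlapLE

lemma IsBlockPositive.productOverlapLE {n : ℕ} {q : BiMatrix n} (hq : IsStarProjection q)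
    (h : IsBlockPositive (1 - 2 • q)) :
    ProductOverlapLE (LinearMap.range (Matrix.toEuclideanLin q)) (1 / √2) := by
  intro x y
  set w := tensorVec x y with hw
  set P := (LinearMap.range (Matrix.toEuclideanLin q)).starProjection with hP
  have hval : Matrix.toEuclideanLin (1 - 2 • q) w = w - 2 • P w := by
    rw [hP, ← toEuclideanCLM_eq_starProjection hq]
    ext i
    simp [Matrix.toLpLin_apply]
  have hinner : (inner ℂ w (P w)).re = ‖P w‖ ^ 2 :=
    (inner_re_symm (𝕜 := ℂ) _ _).trans (Submodule.re_inner_starProjection_eq_normSq _ w)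
  have hsq : 2 * ‖P w‖ ^ 2 ≤ ‖w‖ ^ 2 := by
    have hpos := (Complex.le_def.1 (h x y)).1
    rw [← hw, hval, inner_sub_right, Complex.sub_re] at hpos
    rw [← Nat.cast_smul_eq_nsmul ℝ, inner_smul_right_eq_smul, Complex.smul_re,
      hinner, ← RCLike.re_eq_complex_re, inner_self_eq_norm_sq] at hpos
    simpa using hpos
  rw [← norm_tensorVec, one_div, inv_mul_eq_div, le_div_iff₀ (by positivity)]
  refine (sq_le_sq₀ (by positivity) (by positivity)).1 ?_
  rw [mul_pow, Real.sq_sqrt zero_le_two, mul_comm]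
  exact hsq

end Overlap

end BlockPositive

theorem mainTheorem9_general
    (q : BlockPositive.BiMatrix 3) (hq : IsStarProjection q)
    (hblock : BlockPositive.IsBlockPositive (1 - 2 • q))
    (htrace : (1 - 2 • q).trace = 3)
    (ξ : BlockPositive.BiVector 3) (hξ : ξ ∈ LinearMap.range (Matrix.toEuclideanLin q))
    (hnorm : ‖ξ‖ = 1) :
    (∃ e f : Fin 2 → EuclideanSpace ℂ (Fin 3),
      BlockPositive.IsSchmidtDecomposition ξ (fun _ => 1 / Real.sqrt 2) e f) ∧
    (∀ (k : ℕ) (c : Fin k → ℝ) (e f : Fin k → EuclideanSpace ℂ (Fin 3)),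
      BlockPositive.IsSchmidtDecomposition ξ c e f →
        k = 2 ∧ ∀ i, c i = 1 / Real.sqrt 2) := by
  have hrank : q.rank = 3 := by
    rw [← Nat.cast_inj (R := ℂ), BlockPositive.natCast_rank_eq_trace hq.isIdempotentElem]
    rw [Matrix.trace_sub, Matrix.trace_smul, Matrix.trace_one] at htrace
    norm_num at htrace ⊢
    linear_combination -htrace / 2
  have hdim : 2 < Module.finrank ℂ (LinearMap.range (Matrix.toEuclideanLin q)) := by
    rw [Matrix.toEuclideanLin, Matrix.toLpLin_eq_toLin, ← Matrix.rank_eq_finrank_range_toLin]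
    omega
  have hoverlap := hblock.productOverlapLE hq
  have hdet := hoverlap.det_coeffMatrix_eq_zero hdim hξ
  exact ⟨hoverlap.exists_schmidt hξ hnorm hdet,
    fun _ _ _ _ => hoverlap.schmidt_eq_two hξ hnorm hdet⟩

theorem mainTheorem9
    (s p q : BlockPositive.BiMatrix 3)
    (hs : BlockPositive.IsSymmetry s)
    (hD : s ∈ BlockPositive.setD 3)
    (hp : IsStarProjection p) (hq : IsStarProjection q)
    (hpq : p + q = 1) (hspq : s = p - q)
    (μ : ℂ) (hμ : μ ≠ 0)
    (ξ : BlockPositive.BiVector 3)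
    (hξ : Module.End.HasEigenvector (Matrix.toEuclideanLin q) μ ξ)
    (hnorm : ‖ξ‖ = 1) :
    (∃ e f : Fin 2 → EuclideanSpace ℂ (Fin 3),
      BlockPositive.IsSchmidtDecomposition ξ (fun _ => 1 / Real.sqrt 2) e f) ∧
    (∀ (k : ℕ) (c : Fin k → ℝ) (e f : Fin k → EuclideanSpace ℂ (Fin 3)),
      BlockPositive.IsSchmidtDecomposition ξ c e f →
        k = 2 ∧ ∀ i, c i = 1 / Real.sqrt 2) := by
  obtain rfl : s = 1 - 2 • q := by rw [hspq, ← hpq, two_nsmul]; abel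
  exact mainTheorem9_general q hq hD.2.2.1 (mod_cast hD.2.2.2) ξ
    ⟨μ⁻¹ • ξ, by rw [map_smul, hξ.apply_eq_smul, inv_smul_smul₀ hμ]⟩ hnorm
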